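/- Let $K$ be a field and work in the ring $K[[q]]$ of formal power series, where infinite sums and products are taken with respect to coefficientwise (formal) convergence. For $a,b\in K[[q]]$ with $b$ having zero constant term, put $$(a;b)_\infty=\prod_{j\ge 0}(1-ab^j),\qquad (a;b)_n=\prod_{j=0}^{n-1}(1-ab^j)\quad(n\ge 0),$$ $$(a_1,a_2,a_3;b)_\infty=(a_1;b)_\infty(a_2;b)_\infty(a_3;b)_\infty,$$ and abbreviate $(q)_n=(q;q)_n$, $(q)_\infty=(q;q)_\infty$. **Theorem (Bressoud's identity (3.3), corrected).** For all integers $r>0$ and $0\le i\le r-1$, the sum on the left below converges and $$\sum_{s_1\ge\dots\ge s_{r-1}\ge 0}\frac{q^{s_1^2+\dots+s_{r-1}^2-s_1-\dots-s_i}}{(q)_{s_1-s_2}\cdots(q)_{s_{r-2}-s_{r-1}}(q)_{s_{r-1}}}=\sum_{k=0}^{i}\frac{(q^{2r+1},\,q^{r-i+k},\,q^{r+i-k+1};\,q^{2r+1})_\infty}{(q)_\infty}.$$ The sum runs over all $(r-1)$-tuples of integers $s_1\ge\dots\ge s_{r-1}\ge 0$; for $r=1$ it consists of the single term $1$. -/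

import Mathlib

open scoped PowerSeries PowerSeries.WithPiTopology

section QSeries

variable {K : Type*} [Field K]

/-- The finite `q`-shifted factorial `(a; q)_n = ∏_{0 ≤ j < n} (1 - a q^j)` of formal power series,
for `n ≥ 0`. -/
noncomputable def qFactorial (a q : K⟦X⟧) (n : ℕ) : K⟦X⟧ :=
  ∏ j ∈ Finset.range n, (1 - a * q ^ j)

/-- The infinite `q`-shifted factorial `(a; q)_∞ = ∏_{j ≥ 0} (1 - a q^j)` of formal power series.
The product is taken in the topology of coefficientwise convergence. -/
noncomputable def qFactorialInf [TopologicalSpace K] (a q : K⟦X⟧) : K⟦X⟧ :=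
  ∏' j : ℕ, (1 - a * q ^ j)

/-- `(a₁, a₂, a₃; q)_∞ = (a₁; q)_∞ (a₂; q)_∞ (a₃; q)_∞`. -/
noncomputable def qFactorialInf₃ [TopologicalSpace K] (a₁ a₂ a₃ q : K⟦X⟧) : K⟦X⟧ :=
  qFactorialInf a₁ q * qFactorialInf a₂ q * qFactorialInf a₃ q

/-- The infinite product defining `(a; q)_∞` converges when `q` has zero constant term. -/
theorem multipliable_qFactorialInf [TopologicalSpace K] (a : K⟦X⟧) {q : K⟦X⟧}
    (hq : PowerSeries.constantCoeff q = 0) :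
    Multipliable fun j : ℕ => (1 - a * q ^ j) := by
  simp_rw [sub_eq_add_neg]
  apply PowerSeries.WithPiTopology.multipliable_one_add_of_tendsto_order_atTop_nhds_top
  refine ENat.tendsto_nhds_top_iff_natCast_lt.mpr fun n => ?_
  filter_upwards [Filter.eventually_gt_atTop n] with j hj
  rw [PowerSeries.order_neg]
  refine lt_of_lt_of_le (Nat.cast_lt.mpr hj) ?_
  refine PowerSeries.nat_le_order _ _ fun i hi => ?_
  have h : (PowerSeries.X : K⟦X⟧) ^ j ∣ a * q ^ j :=
    (pow_dvd_pow_of_dvd (PowerSeries.X_dvd_iff.mpr hq) j).mul_left a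
  exact PowerSeries.X_pow_dvd_iff.mp h i hi

/-- `(a; q)_n = (a; q)_∞ / (a q^n; q)_∞`, in the form `(a; q)_n (a q^n; q)_∞ = (a; q)_∞`. -/
theorem qFactorial_mul_qFactorialInf [TopologicalSpace K] [DiscreteTopology K]
    (a : K⟦X⟧) {q : K⟦X⟧} (hq : PowerSeries.constantCoeff q = 0) (n : ℕ) :
    qFactorial a q n * qFactorialInf (a * q ^ n) q = qFactorialInf a q := by
  have h : Multipliable fun j : ℕ => (1 - a * q ^ (j + n)) := by
    simpa only [pow_add, mul_assoc, mul_comm, mul_left_comm] using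
      multipliable_qFactorialInf (a * q ^ n) hq
  have h2 := h.prod_mul_tprod_nat_mul' (f := fun j => 1 - a * q ^ j) (k := n)
  rw [qFactorial, qFactorialInf, qFactorialInf, ← h2]
  congr 1
  refine tprod_congr fun j => ?_
  ring

/-- `(X; X)_n` has constant term `1`, so that `⁻¹` below is a true inverse. -/
theorem constantCoeff_qFactorial_X (n : ℕ) :
    PowerSeries.constantCoeff (qFactorial (PowerSeries.X : K⟦X⟧) PowerSeries.X n) = 1 := by
  simp [qFactorial]

/-- `(X; X)_∞` has constant term `1`, so that `⁻¹` below is a true inverse. -/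
theorem constantCoeff_qFactorialInf_X [TopologicalSpace K] [DiscreteTopology K] :
    PowerSeries.constantCoeff (qFactorialInf (PowerSeries.X : K⟦X⟧) PowerSeries.X) = 1 := by
  have h := (multipliable_qFactorialInf (PowerSeries.X : K⟦X⟧) (q := PowerSeries.X)
    (by simp)).map_tprod (PowerSeries.constantCoeff (R := K))
    (PowerSeries.WithPiTopology.continuous_constantCoeff K)
  rw [qFactorialInf, h]
  simp

end QSeries

/-- For a tuple `s = (s_1, …, s_m)`, stored as `s 0, …, s (m - 1)`, the entry following the one
stored at `j`, with the convention `s_{m+1} = 0`. -/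
def nextEntry {m : ℕ} (s : Fin m → ℕ) (j : Fin m) : ℕ :=
  if h : (j : ℕ) + 1 < m then s ⟨j + 1, h⟩ else 0

/-- The exponent `s_1² + ⋯ + s_m² - s_1 - ⋯ - s_i` (here `i ≤ m`). -/
def bressoudExponent {m : ℕ} (i : ℕ) (s : Fin m → ℕ) : ℕ :=
  (∑ j, s j ^ 2) - ∑ j : Fin m with j.val < i, s j

/-- The subtraction in `bressoudExponent` is never truncated. -/
theorem bressoudExponent_cast {m : ℕ} (i : ℕ) (s : Fin m → ℕ) :
    (bressoudExponent i s : ℤ) = (∑ j, (s j : ℤ) ^ 2) - ∑ j : Fin m with j.val < i, (s j : ℤ) := by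
  have h : (∑ j : Fin m with j.val < i, s j) ≤ ∑ j, s j ^ 2 :=
    (Finset.sum_le_sum_of_subset (Finset.filter_subset _ _)).trans
      (Finset.sum_le_sum fun j _ => Nat.le_self_pow two_ne_zero (s j))
  rw [bressoudExponent, Nat.cast_sub h]
  push_cast
  rfl

/-- The summand `q^{s_1² + ⋯ + s_m² - s_1 - ⋯ - s_i} / ((q)_{s_1 - s_2} ⋯ (q)_{s_{m-1} - s_m} (q)_{s_m})`
as a formal power series in `q = X`. -/
noncomputable def bressoudTerm (K : Type*) [Field K] {m : ℕ} (i : ℕ) (s : Fin m → ℕ) : K⟦X⟧ :=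
  PowerSeries.X ^ bressoudExponent i s *
    (∏ j, qFactorial PowerSeries.X PowerSeries.X (s j - nextEntry s j))⁻¹

/-! The method is that of Bailey chains. Insert a factor 1/(q)_{N - s_1} to get a finite sum,
`nestedSum`, and expand it in the kernels 1/((q)_{N-j} (q)_{N+j}), with j running over the integers.
Summing such a kernel in s against q^{s²}/(q)_{N-s} returns the same kernel at N times q^{j²}
(`sum_sq_mul_invFac`). With q^{s²-s} it returns the kernel times q^{j²}(q^j + q^{-j} - q^N)
(`sum_sq_sub_mul_invFac`). Both follow from q-Chu–Vandermonde.

The chain starts from the expansion of δ_{N,0}, which is the finite Jacobi product at z = 1. After m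
= r - 1 sums, i of them carrying the linear exponent, the coefficient of the kernel is (-1)^j
q^{j(j-1)/2 + (m+1)j²} (U_{i+1} - q^N U_i), where U_n = q^{(n-1)j} + ⋯ + q^{-(n-1)j} obeys the
Chebyshev recurrence (`nestedSum_eq`).

As N → ∞ the U_i term disappears. Cancelling one factor 1/(q)_∞ leaves i + 1 theta series, each a
product by the Jacobi triple product. The symmetry b ↦ 1 - b of these products puts them in the
stated order.

The finite identities involve negative powers, so they are proved in a field and pulled back from
the fraction field of K⟦X⟧. -/

/-- The reciprocal `1 / (q; q)_n`, extended by zero to negative `n`. -/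
noncomputable def invFac {F : Type*} [Field F] (q : F) (n : ℤ) : F :=
  if n < 0 then 0 else (∏ k ∈ Finset.range n.toNat, (1 - q ^ (k + 1)))⁻¹

/-- The polynomial exponent `j (j - 1) / 2`. -/
def tri (j : ℤ) : ℤ := j * (j - 1) / 2

theorem two_mul_tri (j : ℤ) : 2 * tri j = j * (j - 1) := by
  have h : (2 : ℤ) ∣ j * (j - 1) := by
    have := Int.even_mul_pred_self j
    exact this.two_dvd
  exact Int.mul_ediv_cancel' h

theorem tri_add_one (j : ℤ) : tri (j + 1) = tri j + j := by
  have h1 := two_mul_tri j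
  have h2 := two_mul_tri (j + 1)
  linarith

theorem tri_sub_one (j : ℤ) : tri (j - 1) = tri j - (j - 1) := by
  have := tri_add_one (j - 1)
  rw [sub_add_cancel] at this
  linarith

/-! ### q-Chu–Vandermonde and the kernel sums -/

section Field

variable {F : Type*} [Field F] {q : F}

theorem invFac_of_neg (q : F) {n : ℤ} (hn : n < 0) : invFac q n = 0 := if_pos hn

@[simp]
theorem invFac_zero (q : F) : invFac q 0 = 1 := by simp [invFac]

/-- Valid for every integer n: at n = 0 the factor 1 - q^0 vanishes, in agreement with 1/(q)_{-1} =
0. Later recurrences therefore need no boundary cases. -/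
theorem one_sub_zpow_mul_invFac (hq : ∀ n : ℕ, 0 < n → q ^ n ≠ 1) (n : ℤ) :
    (1 - q ^ n) * invFac q n = invFac q (n - 1) := by
  rcases lt_trichotomy n 0 with h | rfl | h
  · rw [invFac_of_neg q h, invFac_of_neg q (by lia), mul_zero]
  · rw [invFac_of_neg q (n := 0 - 1) (by norm_num)]; simp
  · obtain ⟨m, rfl⟩ : ∃ m : ℕ, n = m + 1 := ⟨(n - 1).toNat, by lia⟩
    have h0 : 1 - q ^ (m + 1) ≠ 0 := sub_ne_zero.mpr (hq (m + 1) m.succ_pos).symm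
    have h1 : ((m : ℤ) + 1).toNat = m + 1 := by lia
    rw [invFac, invFac, if_neg (by lia), if_neg (by lia), h1, Finset.prod_range_succ, mul_inv,
      add_sub_cancel_right, Int.toNat_natCast, mul_comm, mul_assoc]
    norm_cast
    rw [inv_mul_cancel₀ h0, mul_one]

theorem invFac_eq (hq : ∀ n : ℕ, 0 < n → q ^ n ≠ 1) {m n : ℤ} (h : m + 1 = n) :
    invFac q m = (1 - q ^ n) * invFac q n := by
  rw [one_sub_zpow_mul_invFac hq, ← h, add_sub_cancel_right]

/-- The `q`-Chu--Vandermonde summation with one infinite parameter. -/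
theorem sum_invFac_vandermonde (hq0 : q ≠ 0) (hq : ∀ n : ℕ, 0 < n → q ^ n ≠ 1) (N : ℕ) (a b : ℤ)
    (ha : a ≤ 0) :
    ∑ s ∈ Finset.range (N + 1), q ^ ((s + a) * (s + b)) *
        (invFac q (N - s) * invFac q (s + a) * invFac q (s + b)) =
      invFac q (N + a) * invFac q (N + b) := by
  induction N generalizing b with
  | zero =>
    rcases ha.lt_or_eq with h | rfl
    · simp [invFac_of_neg q h]
    · simp
  | succ N ih =>
    rcases lt_trichotomy ((N : ℤ) + 1 + a) 0 with h | h | h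
    · rw [invFac_of_neg q (n := ((N + 1 : ℕ) : ℤ) + a) (by push_cast; lia), zero_mul]
      refine Finset.sum_eq_zero fun s hs => ?_
      have := Finset.mem_range.mp hs
      rw [invFac_of_neg q (n := (s : ℤ) + a) (by lia)]
      ring
    · rw [Finset.sum_range_succ, Finset.sum_eq_zero]
      · simp [h]
      · intro s hs
        have := Finset.mem_range.mp hs
        rw [invFac_of_neg q (n := (s : ℤ) + a) (by lia)]
        ring
    · have hne : (1 - q ^ (((N + 1 : ℕ) : ℤ) + a)) ≠ 0 := by
        obtain ⟨m, hm⟩ : ∃ m : ℕ, ((N + 1 : ℕ) : ℤ) + a = m := ⟨(N + 1 + a).toNat, by lia⟩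
        rw [hm, zpow_natCast]
        exact sub_ne_zero.mpr (hq m (by lia)).symm
      apply mul_left_cancel₀ hne
      rw [← mul_assoc, one_sub_zpow_mul_invFac hq]
      have h1 := ih (b + 1)
      have e1 : ((N + 1 : ℕ) : ℤ) + a - 1 = N + a := by push_cast; ring
      have e2 : ((N + 1 : ℕ) : ℤ) + b = N + (b + 1) := by push_cast; ring
      rw [e1, e2, ← h1, Finset.mul_sum]
      -- Telescoping certificate: (1 - q^{N+1+a}) times the summand for (N + 1, b) is the summand
      -- for (N, b + 1) minus U(s+1) - U(s), where U(u) = q^{(u+a)(u+b)} / ((q)_{N+1-u} (q)_{u+a-1}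
      -- (q)_{u+b}).
      have key : ∀ s : ℕ, (1 - q ^ (((N + 1 : ℕ) : ℤ) + a)) * (q ^ (((s : ℤ) + a) * (s + b)) *
          (invFac q (((N + 1 : ℕ) : ℤ) - s) * invFac q (s + a) * invFac q (s + b))) =
          q ^ (((s : ℤ) + a) * (s + (b + 1))) *
            (invFac q (N - s) * invFac q (s + a) * invFac q (s + (b + 1))) -
          (q ^ (((s + 1 : ℕ) + a : ℤ) * ((s + 1 : ℕ) + b)) *
            (invFac q (N - s) * invFac q (s + a) * invFac q (s + (b + 1))) -
          q ^ (((s : ℤ) + a) * (s + b)) *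
            (invFac q (N + 1 - s) * invFac q (s + a - 1) * invFac q (s + b))) := by
        intro s
        rw [invFac_eq hq (m := N - s) (n := N + 1 - s) (by ring),
          invFac_eq hq (m := s + b) (n := s + (b + 1)) (by ring),
          invFac_eq hq (m := s + a - 1) (n := s + a) (by ring)]
        have e3 : q ^ (((s : ℤ) + a) * (s + (b + 1))) =
            q ^ (((s : ℤ) + a) * (s + b)) * q ^ ((s : ℤ) + a) := by
          rw [← zpow_add₀ hq0]; congr 1; ring
        have e4 : q ^ (((s + 1 : ℕ) + a : ℤ) * ((s + 1 : ℕ) + b)) =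
            q ^ (((s : ℤ) + a) * (s + b)) * q ^ ((s : ℤ) + a) * q ^ ((s : ℤ) + (b + 1)) := by
          rw [← zpow_add₀ hq0, ← zpow_add₀ hq0]; congr 1; push_cast; ring
        have e5 : q ^ (((N + 1 : ℕ) : ℤ) + a) = q ^ ((s : ℤ) + a) * q ^ ((N : ℤ) + 1 - s) := by
          rw [← zpow_add₀ hq0]; congr 1; push_cast; ring
        rw [e3, e4, e5]
        push_cast
        ring
      rw [Finset.sum_congr rfl fun s _ => key s, Finset.sum_sub_distrib, Finset.sum_range_succ,
        invFac_of_neg q (n := N - (N + 1 : ℕ)) (by push_cast; lia)]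
      have tele : ∀ s : ℕ, q ^ (((s + 1 : ℕ) + a : ℤ) * ((s + 1 : ℕ) + b)) *
            (invFac q (N - s) * invFac q (s + a) * invFac q (s + (b + 1))) -
          q ^ (((s : ℤ) + a) * (s + b)) *
            (invFac q (N + 1 - s) * invFac q (s + a - 1) * invFac q (s + b)) =
          (fun u : ℕ => q ^ (((u : ℤ) + a) * (u + b)) *
            (invFac q (N + 1 - u) * invFac q (u + a - 1) * invFac q (u + b))) (s + 1) -
          (fun u : ℕ => q ^ (((u : ℤ) + a) * (u + b)) *
            (invFac q (N + 1 - u) * invFac q (u + a - 1) * invFac q (u + b))) s := by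
        intro s
        have e6 : (N : ℤ) + 1 - (s + 1 : ℕ) = N - s := by push_cast; ring
        have e7 : ((s + 1 : ℕ) : ℤ) + a - 1 = s + a := by push_cast; ring
        have e8 : ((s + 1 : ℕ) : ℤ) + b = s + (b + 1) := by push_cast; ring
        simp only [e6, e7, e8]
      rw [Finset.sum_congr rfl fun s _ => tele s, Finset.sum_range_sub (fun u : ℕ => q ^ (((u : ℤ) + a) * (u + b)) *
        (invFac q (N + 1 - u) * invFac q (u + a - 1) * invFac q (u + b)))]
      -- Both ends of the telescoping sum vanish: U(N+2) contains 1/(q)_{-1}, and U(0) contains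
      -- 1/(q)_{a-1} with a ≤ 0.
      have e9 : (N : ℤ) + 1 - (N + 1 + 1 : ℕ) = -1 := by push_cast; ring
      simp only [e9]
      rw [invFac_of_neg q (n := -1) (by lia), invFac_of_neg q (n := ((0 : ℕ) : ℤ) + a - 1)
        (by push_cast; lia)]
      ring

/-- Since s² = j² + (s - j)(s + j), this is Vandermonde with parameters -j and j. The symmetry j ↦
-j supplies the sign condition. -/
theorem sum_sq_mul_invFac (hq0 : q ≠ 0) (hq : ∀ n : ℕ, 0 < n → q ^ n ≠ 1) (N : ℕ) (j : ℤ) :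
    ∑ s ∈ Finset.range (N + 1), invFac q (N - s) * q ^ ((s : ℤ) ^ 2) *
        (invFac q (s - j) * invFac q (s + j)) =
      q ^ (j ^ 2) * (invFac q (N - j) * invFac q (N + j)) := by
  have main : ∀ j : ℤ, 0 ≤ j → ∑ s ∈ Finset.range (N + 1), invFac q (N - s) * q ^ ((s : ℤ) ^ 2) *
        (invFac q (s - j) * invFac q (s + j)) =
      q ^ (j ^ 2) * (invFac q (N - j) * invFac q (N + j)) := by
    intro j hj
    have h := sum_invFac_vandermonde hq0 hq N (-j) j (by lia)
    rw [sub_eq_add_neg (N : ℤ) j, ← h, Finset.mul_sum]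
    refine Finset.sum_congr rfl fun s _ => ?_
    have e : q ^ ((s : ℤ) ^ 2) = q ^ (j ^ 2) * q ^ (((s : ℤ) + -j) * (s + j)) := by
      rw [← zpow_add₀ hq0]; congr 1; ring
    rw [e, sub_eq_add_neg (s : ℤ) j]
    ring
  rcases le_total 0 j with hj | hj
  · exact main j hj
  · have h := main (-j) (by lia)
    simp only [sub_neg_eq_add, ← sub_eq_add_neg, neg_sq] at h
    rw [mul_comm (invFac q (N - j)), ← h]
    exact Finset.sum_congr rfl fun s _ => by ring

/-- Here s² - s = (j² - j) + (s - j)(s + j - 1), and one of -j, j - 1 is always nonpositive. -/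
theorem sum_sq_sub_mul_invFac_pred (hq0 : q ≠ 0) (hq : ∀ n : ℕ, 0 < n → q ^ n ≠ 1) (N : ℕ) (j : ℤ) :
    ∑ s ∈ Finset.range (N + 1), invFac q (N - s) * q ^ ((s : ℤ) ^ 2 - s) *
        (invFac q (s - j) * invFac q (s + j - 1)) =
      q ^ (j ^ 2 - j) * (invFac q (N - j) * invFac q (N + j - 1)) := by
  have e : ∀ s : ℕ, q ^ ((s : ℤ) ^ 2 - s) =
      q ^ (j ^ 2 - j) * q ^ (((s : ℤ) + -j) * (s + (j - 1))) := fun s => by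
    rw [← zpow_add₀ hq0]; congr 1; ring
  rcases le_total 0 j with hj | hj
  · have h := sum_invFac_vandermonde hq0 hq N (-j) (j - 1) (by lia)
    rw [sub_eq_add_neg (N : ℤ) j, add_sub_assoc, ← h, Finset.mul_sum]
    refine Finset.sum_congr rfl fun s _ => ?_
    rw [e, sub_eq_add_neg (s : ℤ) j, add_sub_assoc]
    ring
  · have h := sum_invFac_vandermonde hq0 hq N (j - 1) (-j) (by lia)
    rw [sub_eq_add_neg (N : ℤ) j, add_sub_assoc, mul_comm (invFac q _), ← h, Finset.mul_sum]
    refine Finset.sum_congr rfl fun s _ => ?_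
    rw [e, sub_eq_add_neg (s : ℤ) j, add_sub_assoc, mul_comm ((s : ℤ) + -j)]
    ring

/-- Splitting 1/(q)_{s+j} = 1/(q)_{s+j-1} + q^{s+j}/(q)_{s+j} reduces the sum to the two preceding
ones. -/
theorem sum_sq_sub_mul_invFac (hq0 : q ≠ 0) (hq : ∀ n : ℕ, 0 < n → q ^ n ≠ 1) (N : ℕ) (j : ℤ) :
    ∑ s ∈ Finset.range (N + 1), invFac q (N - s) * q ^ ((s : ℤ) ^ 2 - s) *
        (invFac q (s - j) * invFac q (s + j)) =
      q ^ (j ^ 2) * (q ^ j + q ^ (-j) - q ^ N) * (invFac q (N - j) * invFac q (N + j)) := by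
  have key : ∀ s : ℕ, invFac q (N - s) * q ^ ((s : ℤ) ^ 2 - s) *
        (invFac q (s - j) * invFac q (s + j)) =
      invFac q (N - s) * q ^ ((s : ℤ) ^ 2 - s) * (invFac q (s - j) * invFac q (s + j - 1)) +
      q ^ j * (invFac q (N - s) * q ^ ((s : ℤ) ^ 2) * (invFac q (s - j) * invFac q (s + j))) := by
    intro s
    have e : q ^ ((s : ℤ) ^ 2) = q ^ ((s : ℤ) ^ 2 - s) * q ^ (s : ℤ) := by
      rw [← zpow_add₀ hq0]; congr 1; ring
    rw [← one_sub_zpow_mul_invFac hq, e, zpow_add₀ hq0]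
    ring
  rw [Finset.sum_congr rfl fun s _ => key s, Finset.sum_add_distrib, ← Finset.mul_sum,
    sum_sq_mul_invFac hq0 hq, sum_sq_sub_mul_invFac_pred hq0 hq, ← one_sub_zpow_mul_invFac hq,
    sub_eq_add_neg (j ^ 2), zpow_add₀ hq0, zpow_add₀ hq0, ← zpow_natCast q N]
  have : q ^ (-j) * q ^ j = 1 := by rw [← zpow_add₀ hq0]; simp
  linear_combination (-q ^ (j ^ 2) * q ^ (N : ℤ) * invFac q (N - j) * invFac q (N + j)) * this

end Field

/-! ### Finite Jacobi triple product -/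

section Field

variable {F : Type*} [Field F] {q : F}

theorem sum_Icc_add {f : ℤ → F} {M : ℤ} {c : ℤ}
    (hf : ∀ j, f j ≠ 0 → -M ≤ j ∧ j ≤ M ∧ -M ≤ j - c ∧ j - c ≤ M) :
    ∑ j ∈ Finset.Icc (-M) M, f (j + c) = ∑ j ∈ Finset.Icc (-M) M, f j := by
  rw [← finsum_eq_sum_of_support_subset f, ← finsum_eq_sum_of_support_subset,
    ← finsum_comp_equiv (f := f) (Equiv.addRight c)]
  · rfl
  · intro j hj
    have := hf _ hj
    simp only [Finset.coe_Icc, Set.mem_Icc]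
    lia
  · intro j hj
    have := hf _ hj
    simp only [Finset.coe_Icc, Set.mem_Icc]
    lia

theorem invFac_mul_invFac_eq_zero (q : F) {N j : ℤ} (h : j < -N ∨ N < j) :
    invFac q (N - j) * invFac q (N + j) = 0 := by
  rcases h with h | h
  · rw [invFac_of_neg q (n := N + j) (by lia), mul_zero]
  · rw [invFac_of_neg q (n := N - j) (by lia), zero_mul]

/-- The finite form of the Jacobi triple product. -/
theorem sum_jacobi_finite (hq0 : q ≠ 0) (hq : ∀ n : ℕ, 0 < n → q ^ n ≠ 1) {z : F} (hz : z ≠ 0)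
    (M N : ℕ) (hNM : N ≤ M) :
    ∑ j ∈ Finset.Icc (-(M : ℤ)) M, (-1) ^ j * q ^ tri j * z ^ j *
        (invFac q (N - j) * invFac q (N + j)) =
      invFac q (2 * N) * ∏ k ∈ Finset.range N, ((1 - z * q ^ k) * (1 - z⁻¹ * q ^ (k + 1))) := by
  induction N with
  | zero =>
    rw [Finset.sum_eq_single 0]
    · simp [tri]
    · intro j _ hj
      rw [invFac_mul_invFac_eq_zero q (by push_cast; lia), mul_zero]
    · simp
  | succ N ih =>
    have hne : ∀ n : ℕ, 0 < n → (1 - q ^ (n : ℤ)) ≠ 0 := fun n hn => by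
      rw [zpow_natCast]; exact sub_ne_zero.mpr (hq n hn).symm
    have hm1 : (-1 : F) ≠ 0 := by simp
    apply mul_left_cancel₀ (hne (2 * N + 1) (by lia))
    apply mul_left_cancel₀ (hne (2 * N + 2) (by lia))
    set f : ℤ → F := fun j => (-1) ^ j * q ^ tri j * z ^ j *
        (invFac q (N - j) * invFac q (N + j)) with hf
    have hf0 : ∀ j, f j ≠ 0 → -(N : ℤ) ≤ j ∧ j ≤ N := by
      intro j hj
      by_contra hcon
      exact hj (by rw [hf]; simp only; rw [invFac_mul_invFac_eq_zero q (by lia), mul_zero])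
    -- The three terms mirror the expansion (1 - zq^N)(1 - z⁻¹q^{N+1}) = 1 + q^{2N+1} - zq^N -
    -- z⁻¹q^{N+1}, since multiplication by z^{±1} shifts j. As N + 1 ≤ M, the shifts stay inside the
    -- window of summation.
    have key : ∀ j : ℤ, (1 - q ^ ((2 * N + 2 : ℕ) : ℤ)) * ((1 - q ^ ((2 * N + 1 : ℕ) : ℤ)) *
        ((-1) ^ j * q ^ tri j * z ^ j *
          (invFac q ((N + 1 : ℕ) - j) * invFac q ((N + 1 : ℕ) + j)))) =
        (1 + q ^ (2 * N + 1 : ℤ)) * f j - z * q ^ (N : ℤ) * f (j + -1) -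
          z⁻¹ * q ^ (N + 1 : ℤ) * f (j + 1) := by
      intro j
      have hf' : ∀ j, f j = (-1) ^ j * q ^ tri j * z ^ j *
        (invFac q (N - j) * invFac q (N + j)) := fun _ => rfl
      rw [hf', hf', hf', tri_add_one, ← sub_eq_add_neg j, tri_sub_one]
      rw [show (N : ℤ) - (j - 1) = (N + 1 : ℕ) - j by push_cast; ring,
        show (N : ℤ) + (j + 1) = (N + 1 : ℕ) + j by push_cast; ring,
        invFac_eq hq (m := N - (j + 1)) (n := N - j) (by ring),
        invFac_eq hq (m := N - j) (n := (N + 1 : ℕ) - j) (by push_cast; ring),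
        invFac_eq hq (m := N + (j - 1)) (n := N + j) (by ring),
        invFac_eq hq (m := N + j) (n := (N + 1 : ℕ) + j) (by push_cast; ring)]
      generalize invFac q ((N + 1 : ℕ) - j) = A
      generalize invFac q ((N + 1 : ℕ) + j) = B
      push_cast
      simp only [zpow_sub₀ hq0, zpow_sub₀ hz, zpow_sub₀ hm1, zpow_add₀ hq0,
        zpow_add₀ hz, zpow_add₀ hm1, zpow_one, two_mul]
      have h1 : q ^ j ≠ 0 := zpow_ne_zero _ hq0
      have h3 : q ^ (2 : ℤ) = q * q := by rw [zpow_two]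
      rw [h3]
      generalize q ^ j = x at *
      generalize q ^ (N : ℤ) = y
      field_simp
      ring
    rw [Finset.mul_sum, Finset.mul_sum, Finset.sum_congr rfl fun j _ => key j,
      Finset.sum_sub_distrib, Finset.sum_sub_distrib, ← Finset.mul_sum, ← Finset.mul_sum,
      ← Finset.mul_sum, sum_Icc_add, sum_Icc_add, ih (by lia), Finset.prod_range_succ,
      invFac_eq hq (m := 2 * N) (n := (2 * N + 1 : ℕ)) (by push_cast; ring),
      invFac_eq hq (m := (2 * N + 1 : ℕ)) (n := (2 * N + 2 : ℕ)) (by push_cast; ring)]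
    · have e1 : (2 * ((N + 1 : ℕ) : ℤ)) = (2 * N + 2 : ℕ) := by push_cast; ring
      have e2 : q ^ (2 * N + 1 : ℤ) = q ^ N * q ^ N * q := by
        rw [zpow_add₀ hq0, two_mul, zpow_add₀ hq0, zpow_natCast, zpow_one]
      have e3 : q ^ (N + 1 : ℤ) = q ^ N * q := by
        rw [zpow_add₀ hq0, zpow_natCast, zpow_one]
      rw [e1, e2, e3, zpow_natCast q N, pow_succ]
      field_simp
      ring
    · intro j hj
      have := hf0 j hj
      lia
    · intro j hj
      have := hf0 j hj
      lia

/-- At z = 1 the factor 1 - z kills the product unless N = 0. This is the unit Bailey pair that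
starts the chain. -/
theorem sum_jacobi_one (hq0 : q ≠ 0) (hq : ∀ n : ℕ, 0 < n → q ^ n ≠ 1)
    (M N : ℕ) (hNM : N ≤ M) :
    ∑ j ∈ Finset.Icc (-(M : ℤ)) M, (-1) ^ j * q ^ tri j *
        (invFac q (N - j) * invFac q (N + j)) = if N = 0 then 1 else 0 := by
  have h := sum_jacobi_finite hq0 hq one_ne_zero M N hNM
  simp only [one_zpow, mul_one] at h
  rw [h]
  split_ifs with hN
  · simp [hN]
  · rw [Finset.prod_eq_zero (i := 0) (by simp; lia) (by simp), mul_zero]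

/-! ### Closed form of the finite nested sum -/

/-- The Laurent polynomial `q^{(n-1)j} + q^{(n-3)j} + ⋯ + q^{-(n-1)j}`. -/
def chebSum (q : F) (j : ℤ) (n : ℕ) : F :=
  ∑ k ∈ Finset.range n, q ^ (((n : ℤ) - 1 - 2 * k) * j)

theorem chebSum_zero (q : F) (j : ℤ) : chebSum q j 0 = 0 := by simp [chebSum]

theorem chebSum_one (q : F) (j : ℤ) : chebSum q j 1 = 1 := by simp [chebSum]

theorem chebSum_succ (hq0 : q ≠ 0) (j : ℤ) (n : ℕ) :
    chebSum q j (n + 1) = q ^ j * chebSum q j n + q ^ (-(n * j)) := by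
  rw [chebSum, chebSum, Finset.sum_range_succ, Finset.mul_sum]
  congr 1
  · refine Finset.sum_congr rfl fun k _ => ?_
    rw [← zpow_add₀ hq0]; congr 1; push_cast; ring
  · congr 1; push_cast; ring

/-- The Chebyshev recurrence, in the variable q^j + q^{-j} that each summation with a linear
exponent produces. -/
theorem chebSum_add_two (hq0 : q ≠ 0) (j : ℤ) (n : ℕ) :
    chebSum q j (n + 2) = (q ^ j + q ^ (-j)) * chebSum q j (n + 1) - chebSum q j n := by
  rw [chebSum_succ hq0 j (n + 1)]
  have h := chebSum_succ hq0 j n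
  have h1 : q ^ (-j) * q ^ j = 1 := by rw [← zpow_add₀ hq0]; simp
  have h2 : q ^ (-(((n + 1 : ℕ) : ℤ) * j)) = q ^ (-j) * q ^ (-(n * j)) := by
    rw [← zpow_add₀ hq0]; congr 1; push_cast; ring
  rw [h2]
  linear_combination (-q ^ (-j)) * h - chebSum q j n * h1

/-- The nested sum over `N ≥ s_1 ≥ ⋯ ≥ s_m` of
`q^{s_1² + ⋯ + s_m² - s_1 - ⋯ - s_i} / ((q)_{N - s_1} (q)_{s_1 - s_2} ⋯ (q)_{s_m})`. -/
noncomputable def nestedSum (q : F) : ℕ → ℕ → ℕ → F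
  | 0, _, N => invFac q N
  | m + 1, 0, N => ∑ s ∈ Finset.range (N + 1),
      invFac q (N - s) * q ^ ((s : ℤ) ^ 2) * nestedSum q m 0 s
  | m + 1, i + 1, N => ∑ s ∈ Finset.range (N + 1),
      invFac q (N - s) * q ^ ((s : ℤ) ^ 2 - s) * nestedSum q m i s

theorem nestedSum_zero_right_eq (hq0 : q ≠ 0) (hq : ∀ n : ℕ, 0 < n → q ^ n ≠ 1)
    (M m N : ℕ) (hNM : N ≤ M) :
    nestedSum q m 0 N = ∑ j ∈ Finset.Icc (-(M : ℤ)) M, (-1) ^ j * q ^ (tri j + (m + 1) * j ^ 2) *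
      (invFac q (N - j) * invFac q (N + j)) := by
  -- One link of the chain: exchanging the two sums multiplies the coefficient of each kernel by
  -- q^{j²}.
  have step : ∀ (N : ℕ) (g : ℕ → F) (c : ℤ → F),
      (∀ n ≤ N, g n = ∑ j ∈ Finset.Icc (-(M : ℤ)) M, c j * (invFac q (n - j) * invFac q (n + j))) →
      ∑ s ∈ Finset.range (N + 1), invFac q (N - s) * q ^ ((s : ℤ) ^ 2) * g s =
        ∑ j ∈ Finset.Icc (-(M : ℤ)) M, c j * q ^ (j ^ 2) *
          (invFac q (N - j) * invFac q (N + j)) := by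
    intro N g c hg
    rw [Finset.sum_congr rfl fun s hs => by
      rw [hg s (Nat.lt_succ_iff.mp (Finset.mem_range.mp hs)), Finset.mul_sum], Finset.sum_comm]
    refine Finset.sum_congr rfl fun j _ => ?_
    rw [mul_assoc (c j), ← sum_sq_mul_invFac hq0 hq, Finset.mul_sum]
    exact Finset.sum_congr rfl fun s _ => by ring
  induction m generalizing N with
  | zero =>
    -- The case m = 0 is itself one link, applied to δ_{n,0}: only s = 0 survives, leaving 1/(q)_N.
    -- Hence the exponent has m + 1 copies of j² rather than m.
    have h := step N (fun n => if n = 0 then 1 else 0) (fun j => (-1) ^ j * q ^ tri j)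
      fun n hn => (sum_jacobi_one hq0 hq M n (hn.trans hNM)).symm
    rw [Finset.sum_eq_single 0 (by intro b _ hb; simp [hb]) (by simp)] at h
    simp only [nestedSum]
    simp only [Nat.cast_zero, sub_zero, if_true, mul_one, ne_eq, OfNat.ofNat_ne_zero,
      not_false_eq_true, zero_pow, zpow_zero] at h
    rw [h]
    refine Finset.sum_congr rfl fun j _ => ?_
    rw [mul_assoc ((-1) ^ j), ← zpow_add₀ hq0]
    simp
  | succ m ih =>
    rw [nestedSum, step N _ _ fun n hn => ih n (hn.trans hNM)]
    refine Finset.sum_congr rfl fun j _ => ?_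
    rw [mul_assoc ((-1) ^ j), ← zpow_add₀ hq0]
    congr 3; push_cast; ring

/-- The form of the factor is preserved by a linear-exponent link: the q^s in front of U_i turns
q^{s²-s} into q^{s²}, and (q^j + q^{-j} - q^N) U_{i+1} - U_i = U_{i+2} - q^N U_{i+1}. -/
theorem nestedSum_eq (hq0 : q ≠ 0) (hq : ∀ n : ℕ, 0 < n → q ^ n ≠ 1)
    (M m i N : ℕ) (him : i ≤ m) (hNM : N ≤ M) :
    nestedSum q m i N = ∑ j ∈ Finset.Icc (-(M : ℤ)) M, (-1) ^ j * q ^ (tri j + (m + 1) * j ^ 2) *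
      (chebSum q j (i + 1) - q ^ N * chebSum q j i) *
      (invFac q (N - j) * invFac q (N + j)) := by
  induction i generalizing m N with
  | zero =>
    rw [nestedSum_zero_right_eq hq0 hq M m N hNM]
    simp [chebSum_zero, chebSum_one]
  | succ i ih =>
    obtain ⟨m, rfl⟩ : ∃ m', m = m' + 1 := ⟨m - 1, by lia⟩
    rw [nestedSum, Finset.sum_congr rfl fun s hs => by
      rw [ih m s (by lia) ((Nat.lt_succ_iff.mp (Finset.mem_range.mp hs)).trans hNM),
        Finset.mul_sum], Finset.sum_comm]
    refine Finset.sum_congr rfl fun j _ => ?_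
    have h1 := sum_sq_sub_mul_invFac hq0 hq N j
    have h2 := sum_sq_mul_invFac hq0 hq N j
    have key : ∀ s : ℕ, invFac q (N - s) * q ^ ((s : ℤ) ^ 2 - s) *
        ((-1) ^ j * q ^ (tri j + (m + 1) * j ^ 2) *
          (chebSum q j (i + 1) - q ^ s * chebSum q j i) * (invFac q (s - j) * invFac q (s + j))) =
        ((-1) ^ j * q ^ (tri j + (m + 1) * j ^ 2) * chebSum q j (i + 1)) *
          (invFac q (N - s) * q ^ ((s : ℤ) ^ 2 - s) * (invFac q (s - j) * invFac q (s + j))) -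
        ((-1) ^ j * q ^ (tri j + (m + 1) * j ^ 2) * chebSum q j i) *
          (invFac q (N - s) * q ^ ((s : ℤ) ^ 2) * (invFac q (s - j) * invFac q (s + j))) := by
      intro s
      have e : q ^ ((s : ℤ) ^ 2) = q ^ ((s : ℤ) ^ 2 - s) * q ^ s := by
        rw [← zpow_natCast q s, ← zpow_add₀ hq0]; congr 1; ring
      rw [e]; ring
    have e : q ^ (tri j + ((m + 1 : ℕ) + 1 : ℤ) * j ^ 2) =
        q ^ (tri j + (m + 1) * j ^ 2) * q ^ (j ^ 2) := by
      rw [← zpow_add₀ hq0]; congr 1; push_cast; ring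
    rw [Finset.sum_congr rfl fun s _ => key s, Finset.sum_sub_distrib, ← Finset.mul_sum,
      ← Finset.mul_sum, h1, h2, e, chebSum_add_two hq0]
    ring

end Field

/-! ### Coefficientwise limits -/

section Limits

theorem HasSum.of_eq_of_eq {ι A : Type*} [AddCommMonoid A] [TopologicalSpace A] {f g : ι → A}
    {a b : A} (h : HasSum f a) (hfg : ∀ j, f j = g j) (hab : a = b) : HasSum g b := by
  rwa [← hab, ← funext hfg]

open Filter Topology

variable {K : Type*} [Field K]

/-- Termwise passage to the limit in a sum of formal power series, of which only finitely many terms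
contribute to a given coefficient. -/
theorem hasSum_iff_tendsto_of_eventually_coeff_eq_zero [TopologicalSpace K]
    [DiscreteTopology K] {ι : Type*} {f : ℕ → ι → K⟦X⟧}
    {S : ℕ → K⟦X⟧} {g : ι → K⟦X⟧} {L : K⟦X⟧} (hf : ∀ N, HasSum (f N) (S N))
    (hg : ∀ j, Tendsto (fun N => f N j) atTop (𝓝 (g j)))
    (hs : ∀ n, ∃ s : Finset ι, ∀ j ∉ s, ∀ N, PowerSeries.coeff n (f N j) = 0) :
    HasSum g L ↔ Tendsto S atTop (𝓝 L) := by
  rw [PowerSeries.WithPiTopology.hasSum_iff_hasSum_coeff,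
    PowerSeries.WithPiTopology.tendsto_iff_coeff_tendsto]
  refine forall_congr' fun n => ?_
  obtain ⟨s, hs⟩ := hs n
  have hg' : ∀ j, Tendsto (fun N => PowerSeries.coeff n (f N j)) atTop
      (𝓝 (PowerSeries.coeff n (g j))) := fun j =>
    (PowerSeries.WithPiTopology.tendsto_iff_coeff_tendsto K _ _ _).mp (hg j) n
  have hg0 : ∀ j ∉ s, PowerSeries.coeff n (g j) = 0 := fun j hj =>
    tendsto_nhds_unique (hg' j) (by simp only [hs j hj]; exact tendsto_const_nhds)
  have hS : ∀ N, PowerSeries.coeff n (S N) = ∑ j ∈ s, PowerSeries.coeff n (f N j) := fun N =>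
    (((PowerSeries.WithPiTopology.hasSum_iff_hasSum_coeff K).mp (hf N)) n).unique
      (hasSum_sum_of_ne_finset_zero fun j hj => hs j hj N)
  have h1 : HasSum (fun j => PowerSeries.coeff n (g j)) (∑ j ∈ s, PowerSeries.coeff n (g j)) :=
    hasSum_sum_of_ne_finset_zero hg0
  have h2 : Tendsto (fun N => PowerSeries.coeff n (S N)) atTop
      (𝓝 (∑ j ∈ s, PowerSeries.coeff n (g j))) := by
    simp only [hS]
    exact tendsto_finsetSum _ fun j _ => hg' j
  constructor
  · intro h
    rwa [h.unique h1]
  · intro h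
    rwa [tendsto_nhds_unique h h2]

/-- From 1/a - 1/b = (b - a)/(ab), agreement of a and b modulo X^{d+1} passes to their inverses. -/
theorem tendsto_powerSeries_inv [TopologicalSpace K]
    [DiscreteTopology K] {ι : Type*} {l : Filter ι} {a : ι → K⟦X⟧} {b : K⟦X⟧}
    (h : Tendsto a l (𝓝 b)) (ha : ∀ n, PowerSeries.constantCoeff (a n) = 1)
    (hb : PowerSeries.constantCoeff b = 1) : Tendsto (fun n => (a n)⁻¹) l (𝓝 b⁻¹) := by
  rw [PowerSeries.WithPiTopology.tendsto_iff_coeff_tendsto] at h ⊢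
  intro d
  rw [nhds_discrete, tendsto_pure]
  have h' : ∀ᶠ n in l, ∀ k ∈ Finset.range (d + 1),
      PowerSeries.coeff k (a n) = PowerSeries.coeff k b := by
    rw [Filter.eventually_all_finset]
    intro k _
    have := h k
    rwa [nhds_discrete, tendsto_pure] at this
  filter_upwards [h'] with n hn
  have hdvd : (PowerSeries.X : K⟦X⟧) ^ (d + 1) ∣ b - a n := by
    rw [PowerSeries.X_pow_dvd_iff]
    intro m hm
    rw [map_sub, hn m (Finset.mem_range.mpr hm), sub_self]
  have e : (a n)⁻¹ - b⁻¹ = (b - a n) * ((a n)⁻¹ * b⁻¹) := by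
    have h1 : a n * (a n)⁻¹ = 1 := PowerSeries.mul_inv_cancel _ (by simp [ha])
    have h2 : b * b⁻¹ = 1 := PowerSeries.mul_inv_cancel _ (by simp [hb])
    linear_combination (-(a n)⁻¹) * h2 + b⁻¹ * h1
  have := PowerSeries.X_pow_dvd_iff.mp (e ▸ hdvd.mul_right _ :
    (PowerSeries.X : K⟦X⟧) ^ (d + 1) ∣ (a n)⁻¹ - b⁻¹) d (Nat.lt_succ_self d)
  rwa [map_sub, sub_eq_zero] at this

theorem tendsto_qFactorial [TopologicalSpace K] (a : K⟦X⟧) {q : K⟦X⟧} (hq : PowerSeries.constantCoeff q = 0) :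
    Tendsto (qFactorial a q) atTop (𝓝 (qFactorialInf a q)) :=
  (multipliable_qFactorialInf a hq).hasProd.tendsto_prod_nat

theorem constantCoeff_qFactorial {q : K⟦X⟧} (hq : PowerSeries.constantCoeff q = 0) (n : ℕ) :
    PowerSeries.constantCoeff (qFactorial q q n) = 1 := by
  simp [qFactorial, hq]

theorem constantCoeff_qFactorialInf [TopologicalSpace K] [DiscreteTopology K] {q : K⟦X⟧}
    (hq : PowerSeries.constantCoeff q = 0) :
    PowerSeries.constantCoeff (qFactorialInf q q) = 1 := by
  refine tendsto_nhds_unique (((PowerSeries.WithPiTopology.continuous_constantCoeff K).tendsto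
    _).comp (tendsto_qFactorial q hq)) ?_
  simp only [Function.comp_def, constantCoeff_qFactorial hq]
  exact tendsto_const_nhds

theorem qFactorialInf_mul_inv [TopologicalSpace K] [DiscreteTopology K] {q : K⟦X⟧}
    (hq : PowerSeries.constantCoeff q = 0) :
    qFactorialInf q q * (qFactorialInf q q)⁻¹ = 1 :=
  PowerSeries.mul_inv_cancel _ (by simp [constantCoeff_qFactorialInf hq])

end Limits

/-! ### Passage to the fraction field -/

/-- The power series `1 / (q; q)_n`, extended by zero to negative `n`. -/
noncomputable def invFacSeries {K : Type*} [Field K] (q : K⟦X⟧) (n : ℤ) : K⟦X⟧ :=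
  if n < 0 then 0 else (qFactorial q q n.toNat)⁻¹

section Transport

variable {K : Type*} [Field K]

theorem invFacSeries_of_neg (q : K⟦X⟧) {n : ℤ} (hn : n < 0) : invFacSeries q n = 0 := if_pos hn

theorem tendsto_invFacSeries [TopologicalSpace K] [DiscreteTopology K] {q : K⟦X⟧}
    (hq : PowerSeries.constantCoeff q = 0) :
    Filter.Tendsto (invFacSeries q) Filter.atTop (nhds (qFactorialInf q q)⁻¹) := by
  have h := (tendsto_powerSeries_inv (tendsto_qFactorial q hq) (constantCoeff_qFactorial hq)
    (constantCoeff_qFactorialInf hq)).comp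
      (Filter.tendsto_atTop_atTop.mpr fun b => ⟨(b : ℤ), fun a ha => by lia⟩ :
        Filter.Tendsto Int.toNat Filter.atTop Filter.atTop)
  refine h.congr' ?_
  filter_upwards [Filter.eventually_ge_atTop 0] with n hn
  rw [invFacSeries, if_neg (by lia), Function.comp]

theorem tendsto_invFacSeries_add [TopologicalSpace K] [DiscreteTopology K] {q : K⟦X⟧}
    (hq : PowerSeries.constantCoeff q = 0) (c : ℤ) :
    Filter.Tendsto (fun N : ℕ => invFacSeries q (N + c)) Filter.atTop
      (nhds (qFactorialInf q q)⁻¹) :=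
  (tendsto_invFacSeries hq).comp
    (Filter.tendsto_atTop_add_const_right _ c tendsto_natCast_atTop_atTop)

local notation "ιF" => algebraMap K⟦X⟧ (FractionRing K⟦X⟧)

theorem algebraMap_powerSeries_inv {f : K⟦X⟧} (hf : PowerSeries.constantCoeff f ≠ 0) :
    ιF f⁻¹ = (ιF f)⁻¹ := by
  apply eq_inv_of_mul_eq_one_left
  rw [← map_mul, PowerSeries.inv_mul_cancel _ hf, map_one]

theorem algebraMap_invFacSeries {q : K⟦X⟧} (hq : PowerSeries.constantCoeff q = 0) (n : ℤ) :
    ιF (invFacSeries q n) = invFac (ιF q) n := by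
  rw [invFacSeries, invFac]
  split_ifs
  · simp
  · rw [algebraMap_powerSeries_inv (by simp [qFactorial, hq]), qFactorial, map_prod]
    simp [pow_succ']

theorem algebraMap_X_pow_toNat {e : ℤ} (he : 0 ≤ e) :
    ιF (PowerSeries.X ^ e.toNat) = (ιF PowerSeries.X) ^ e := by
  rw [map_pow, ← zpow_natCast, Int.toNat_of_nonneg he]

theorem algebraMap_X_ne_zero : ιF PowerSeries.X ≠ 0 := by
  simp [PowerSeries.X_ne_zero]

theorem algebraMap_X_pow_ne_one (n : ℕ) (hn : 0 < n) : (ιF PowerSeries.X) ^ n ≠ 1 := by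
  rw [← map_pow, ← map_one ιF]
  intro h
  have := congrArg PowerSeries.constantCoeff (IsFractionRing.injective K⟦X⟧ _ h)
  simp [hn.ne'] at this

theorem neg_one_zpow_eq_pow_natAbs {F : Type*} [Field F] (j : ℤ) :
    (-1 : F) ^ j = (-1) ^ j.natAbs := by
  rcases Int.natAbs_eq j with h | h
  · conv_lhs => rw [h]
    rw [zpow_natCast]
  · conv_lhs => rw [h]
    rw [zpow_neg, zpow_natCast, ← inv_pow, inv_neg_one]

end Transport

/-! ### Jacobi triple product for power series -/

/-- For j > 0 use a ≥ 1. For j ≤ 0 rewrite the exponent as L j(j+1)/2 + (L - a)|j| and use L - a ≥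
1. The bound makes `toNat` harmless and lets only |j| ≤ n reach the coefficient of degree n. -/
theorem abs_le_jacobiExponent {L a : ℤ} (ha : 0 < a) (haL : a < L) (j : ℤ) :
    |j| ≤ L * tri j + a * j := by
  have h := two_mul_tri j
  have h2 : 2 * (L * tri j + a * j) = L * (j * (j - 1)) + 2 * a * j := by rw [← h]; ring
  rcases lt_or_ge 0 j with hj | hj
  · rw [abs_of_pos hj]
    nlinarith [mul_nonneg (by lia : 0 ≤ L) (mul_nonneg hj.le (by lia : 0 ≤ j - 1)),
      mul_nonneg (by lia : 0 ≤ a - 1) hj.le]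
  · rw [abs_of_nonpos hj]
    have : 0 ≤ j * (j + 1) := by
      rcases hj.lt_or_eq with h | rfl
      · nlinarith
      · simp
    nlinarith [mul_nonneg (by lia : 0 ≤ L) this, mul_nonneg (by lia : 0 ≤ L - a - 1) (neg_nonneg.mpr hj)]

theorem coeff_mul_X_pow_jacobiExponent_mul {K : Type*} [Field K] {L a : ℤ} (ha : 0 < a)
    (haL : a < L) {j : ℤ} {n : ℕ} (hj : j ∉ Finset.Icc (-(n : ℤ)) n) (b c : K⟦X⟧) :
    PowerSeries.coeff n (b * PowerSeries.X ^ (L * tri j + a * j).toNat * c) = 0 := by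
  have h := abs_le_jacobiExponent ha haL j
  rw [Finset.mem_Icc, ← abs_le, not_le] at hj
  exact PowerSeries.X_pow_dvd_iff.mp ((dvd_mul_left _ _).mul_right _) n (by lia)

section Jacobi

open Filter Topology

variable {K : Type*} [Field K]

local notation "ιF" => algebraMap K⟦X⟧ (FractionRing K⟦X⟧)

theorem sum_jacobi_finite_series {L a : ℕ} (ha : 0 < a) (haL : a < L) (N : ℕ) :
    ∑ j ∈ Finset.Icc (-(N : ℤ)) N, (-1) ^ j.natAbs *
        (PowerSeries.X : K⟦X⟧) ^ ((L : ℤ) * tri j + a * j).toNat *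
        (invFacSeries (PowerSeries.X ^ L) (N - j) * invFacSeries (PowerSeries.X ^ L) (N + j)) =
      invFacSeries (PowerSeries.X ^ L) (2 * N) *
        (qFactorial (PowerSeries.X ^ a) (PowerSeries.X ^ L) N *
          qFactorial (PowerSeries.X ^ (L - a)) (PowerSeries.X ^ L) N) := by
  apply IsFractionRing.injective K⟦X⟧ (FractionRing K⟦X⟧)
  have hX : ιF PowerSeries.X ≠ 0 := algebraMap_X_ne_zero
  have hq : PowerSeries.constantCoeff ((PowerSeries.X : K⟦X⟧) ^ L) = 0 := by
    simp [(ha.trans haL).ne']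
  have h := sum_jacobi_finite (q := (ιF PowerSeries.X) ^ L) (pow_ne_zero _ hX)
    (fun n hn => by rw [← pow_mul]; exact algebraMap_X_pow_ne_one _ (Nat.mul_pos (by lia) hn))
    (z := (ιF PowerSeries.X) ^ a) (pow_ne_zero _ hX) N N le_rfl
  rw [Finset.prod_mul_distrib] at h
  simp only [map_sum, map_mul, algebraMap_invFacSeries hq, map_pow, qFactorial, map_prod, map_sub,
    map_one, map_neg]
  convert h using 1
  · refine Finset.sum_congr rfl fun j _ => ?_
    rw [neg_one_zpow_eq_pow_natAbs, ← map_pow, algebraMap_X_pow_toNat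
      ((abs_nonneg j).trans (abs_le_jacobiExponent (by lia) (by lia) j)), zpow_add₀ hX, zpow_mul,
      zpow_mul, zpow_natCast, zpow_natCast]
    ring
  · congr 2
    refine Finset.prod_congr rfl fun k _ => ?_
    -- This turns z⁻¹q^{k+1}, with z = X^a and q = X^L, into X^{L-a} (X^L)^k.
    have : (ιF PowerSeries.X) ^ L = (ιF PowerSeries.X) ^ (L - a) * (ιF PowerSeries.X) ^ a := by
      rw [← pow_add]; congr 1; lia
    have h1 := pow_ne_zero a hX
    rw [pow_succ', ← mul_assoc]
    nth_rewrite 2 [this]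
    field_simp

/-- The Jacobi triple product identity for formal power series, with base `X ^ L` and
argument `X ^ a`. -/
theorem hasSum_jacobi [TopologicalSpace K] [DiscreteTopology K] {L a : ℕ} (ha : 0 < a)
    (haL : a < L) :
    HasSum (fun j : ℤ => (-1) ^ j.natAbs *
        (PowerSeries.X : K⟦X⟧) ^ ((L : ℤ) * tri j + a * j).toNat)
      (qFactorialInf₃ (PowerSeries.X ^ L) (PowerSeries.X ^ a) (PowerSeries.X ^ (L - a))
        (PowerSeries.X ^ L)) := by
  have hq : PowerSeries.constantCoeff ((PowerSeries.X : K⟦X⟧) ^ L) = 0 := by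
    simp [(ha.trans haL).ne']
  set Q : K⟦X⟧ := PowerSeries.X ^ L with hQ
  have hS : Tendsto (fun N : ℕ => invFacSeries Q (2 * N) *
      (qFactorial (PowerSeries.X ^ a) Q N * qFactorial (PowerSeries.X ^ (L - a)) Q N)) atTop
      (𝓝 ((qFactorialInf Q Q)⁻¹ * (qFactorialInf (PowerSeries.X ^ a) Q *
        qFactorialInf (PowerSeries.X ^ (L - a)) Q))) := by
    refine Tendsto.mul ?_ ((tendsto_qFactorial _ hq).mul (tendsto_qFactorial _ hq))
    refine (tendsto_invFacSeries hq).comp (tendsto_atTop_mono (fun N => ?_)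
      tendsto_natCast_atTop_atTop)
    lia
  have key := (hasSum_iff_tendsto_of_eventually_coeff_eq_zero
    (f := fun (N : ℕ) (j : ℤ) => (-1) ^ j.natAbs *
        (PowerSeries.X : K⟦X⟧) ^ ((L : ℤ) * tri j + a * j).toNat *
        (invFacSeries Q (N - j) * invFacSeries Q (N + j)))
    (g := fun j => (-1) ^ j.natAbs *
        (PowerSeries.X : K⟦X⟧) ^ ((L : ℤ) * tri j + a * j).toNat *
        ((qFactorialInf Q Q)⁻¹ * (qFactorialInf Q Q)⁻¹)) (fun N => ?_) (fun j => ?_)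
    (fun n => ⟨_, fun j hj N => coeff_mul_X_pow_jacobiExponent_mul (by lia) (by lia) hj _ _⟩)).mpr hS
  -- The limit carries (Q;Q)_∞⁻² on the series side and (Q;Q)_∞⁻¹ on the product side. Clearing both
  -- leaves the third factor (Q;Q)_∞ of the product.
  · have h := key.mul_right (qFactorialInf Q Q * qFactorialInf Q Q)
    have h1 := qFactorialInf_mul_inv hq
    refine h.of_eq_of_eq (fun j => ?_) ?_
    · linear_combination ((-1) ^ j.natAbs *
        (PowerSeries.X : K⟦X⟧) ^ ((L : ℤ) * tri j + a * j).toNat *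
        (qFactorialInf Q Q * (qFactorialInf Q Q)⁻¹ + 1)) * h1
    · rw [qFactorialInf₃]
      linear_combination (qFactorialInf (PowerSeries.X ^ a) Q *
        qFactorialInf (PowerSeries.X ^ (L - a)) Q * qFactorialInf Q Q) * h1
  · rw [← sum_jacobi_finite_series ha haL]
    refine hasSum_sum_of_ne_finset_zero fun j hj => ?_
    rw [Finset.mem_Icc, not_and_or, not_le, not_le] at hj
    rcases hj with h | h
    · rw [invFacSeries_of_neg _ (n := N + j) (by lia)]; ring
    · rw [invFacSeries_of_neg _ (n := N - j) (by lia)]; ring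
  · refine tendsto_const_nhds.mul (Tendsto.mul ?_ (tendsto_invFacSeries_add hq j))
    simpa only [sub_eq_add_neg] using tendsto_invFacSeries_add hq (-j)

end Jacobi

/-! ### The nested sum as a sum over tuples -/

section ChainSum

variable {K : Type*} [Field K]

local notation "ιF" => algebraMap K⟦X⟧ (FractionRing K⟦X⟧)

/-- The summand of `nestedSum` at the tuple `(s_1, …, s_m)`. -/
noncomputable def chainTerm (K : Type*) [Field K] : (m : ℕ) → ℕ → ℕ → (Fin m → ℕ) → K⟦X⟧
  | 0, _, N, _ => invFacSeries PowerSeries.X N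
  | m + 1, 0, N, s => invFacSeries PowerSeries.X (N - s 0) * PowerSeries.X ^ (s 0 ^ 2) *
      chainTerm K m 0 (s 0) (Fin.tail s)
  | m + 1, i + 1, N, s => invFacSeries PowerSeries.X (N - s 0) * PowerSeries.X ^ (s 0 ^ 2 - s 0) *
      chainTerm K m i (s 0) (Fin.tail s)

theorem sum_piFinset_range_succ {A : Type*} [AddCommMonoid A] (m M : ℕ)
    (g : ℕ → (Fin m → ℕ) → A) :
    ∑ s ∈ Fintype.piFinset fun _ : Fin (m + 1) => Finset.range M, g (s 0) (Fin.tail s) =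
      ∑ n ∈ Finset.range M, ∑ s ∈ Fintype.piFinset fun _ : Fin m => Finset.range M, g n s := by
  rw [← Finset.sum_product']
  refine Finset.sum_nbij' (fun s => (s 0, Fin.tail s)) (fun p => Fin.cons p.1 p.2) ?_ ?_ ?_ ?_ ?_
  · intro s hs
    simp only [Fintype.mem_piFinset, Finset.mem_product] at hs ⊢
    exact ⟨hs 0, fun j => hs j.succ⟩
  · intro p hp
    simp only [Fintype.mem_piFinset, Finset.mem_product] at hp ⊢
    exact Fin.cases hp.1 hp.2
  · intro s _
    exact Fin.cons_self_tail s
  · intro p _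
    simp
  · intro s _
    rfl

theorem sum_range_extend_of_invFac {F : Type*} [Field F] (q : F) {N M : ℕ} (hNM : N ≤ M)
    (g : ℕ → F) :
    ∑ n ∈ Finset.range (M + 1), invFac q (N - n) * g n =
      ∑ n ∈ Finset.range (N + 1), invFac q (N - n) * g n := by
  refine (Finset.sum_subset (Finset.range_mono (by lia)) fun n _ hn => ?_).symm
  rw [Finset.mem_range] at hn
  rw [invFac_of_neg q (by lia), zero_mul]

theorem algebraMap_sum_chainTerm (M m i N : ℕ) (hNM : N ≤ M) :
    ιF (∑ s ∈ Fintype.piFinset fun _ : Fin m => Finset.range (M + 1), chainTerm K m i N s) =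
      nestedSum (ιF PowerSeries.X) m i N := by
  have hX0 : PowerSeries.constantCoeff (PowerSeries.X : K⟦X⟧) = 0 := by simp
  induction m generalizing i N with
  | zero => simp [chainTerm, nestedSum, algebraMap_invFacSeries hX0]
  | succ m ih =>
    cases i with
    | zero =>
      simp only [chainTerm, nestedSum]
      rw [sum_piFinset_range_succ m (M + 1) fun n s => invFacSeries PowerSeries.X (N - n) *
        PowerSeries.X ^ (n ^ 2) * chainTerm K m 0 n s, map_sum]
      simp only [mul_assoc]
      rw [← sum_range_extend_of_invFac _ hNM]
      refine Finset.sum_congr rfl fun n hn => ?_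
      rw [← Finset.mul_sum, ← Finset.mul_sum, map_mul, map_mul, algebraMap_invFacSeries hX0,
        ih 0 n (Nat.lt_succ_iff.mp (Finset.mem_range.mp hn)), map_pow]
      norm_cast
    | succ i =>
      simp only [chainTerm, nestedSum]
      rw [sum_piFinset_range_succ m (M + 1) fun n s => invFacSeries PowerSeries.X (N - n) *
        PowerSeries.X ^ (n ^ 2 - n) * chainTerm K m i n s, map_sum]
      simp only [mul_assoc]
      rw [← sum_range_extend_of_invFac _ hNM]
      refine Finset.sum_congr rfl fun n hn => ?_
      rw [← Finset.mul_sum, ← Finset.mul_sum, map_mul, map_mul, algebraMap_invFacSeries hX0,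
        ih i n (Nat.lt_succ_iff.mp (Finset.mem_range.mp hn)), map_pow, ← zpow_natCast,
        Nat.cast_sub (Nat.le_self_pow two_ne_zero n), Nat.cast_pow]

/-- The entry `s_1` of a tuple, zero for the empty tuple. -/
def headEntry {m : ℕ} (s : Fin m → ℕ) : ℕ := if h : 0 < m then s ⟨0, h⟩ else 0

@[simp]
theorem headEntry_succ {m : ℕ} (s : Fin (m + 1) → ℕ) : headEntry s = s 0 := rfl

theorem antitone_of_tail {m : ℕ} {s : Fin (m + 1) → ℕ} (h : Antitone (Fin.tail s))
    (h0 : headEntry (Fin.tail s) ≤ s 0) : Antitone s := by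
  intro a b hab
  induction a using Fin.cases with
  | zero =>
    induction b using Fin.cases with
    | zero => rfl
    | succ b =>
      cases m with
      | zero => exact b.elim0
      | succ m => exact (h (Fin.zero_le b)).trans h0
  | succ a =>
    induction b using Fin.cases with
    | zero => exact absurd hab (by simp)
    | succ b => exact h (Fin.succ_le_succ_iff.mp hab)

/-- Each factor 1/(q)_{s_k - s_{k+1}} vanishes at negative index, so the sum over a full box is
already the sum over decreasing tuples bounded by N. -/
theorem antitone_of_chainTerm_ne_zero {m i N : ℕ} {s : Fin m → ℕ} (h : chainTerm K m i N s ≠ 0) :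
    Antitone s ∧ headEntry s ≤ N := by
  induction m generalizing i N with
  | zero => exact ⟨fun a => a.elim0, Nat.zero_le _⟩
  | succ m ih =>
    have hN : invFacSeries (PowerSeries.X : K⟦X⟧) (N - s 0) ≠ 0 ∧
        ∃ i', chainTerm K m i' (s 0) (Fin.tail s) ≠ 0 := by
      cases i with
      | zero =>
        rw [chainTerm] at h
        exact ⟨left_ne_zero_of_mul (left_ne_zero_of_mul h), _, right_ne_zero_of_mul h⟩
      | succ i =>
        rw [chainTerm] at h
        exact ⟨left_ne_zero_of_mul (left_ne_zero_of_mul h), _, right_ne_zero_of_mul h⟩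
    obtain ⟨h1, i', h2⟩ := hN
    obtain ⟨h3, h4⟩ := ih h2
    refine ⟨antitone_of_tail h3 h4, ?_⟩
    by_contra hcon
    rw [headEntry_succ, not_le] at hcon
    exact h1 (invFacSeries_of_neg _ (by lia))

theorem le_headEntry {m : ℕ} {s : Fin m → ℕ} (h : Antitone s) (j : Fin m) : s j ≤ headEntry s := by
  cases m with
  | zero => exact j.elim0
  | succ m => exact h (Fin.zero_le j)

theorem antitone_tail {m : ℕ} {s : Fin (m + 1) → ℕ} (h : Antitone s) : Antitone (Fin.tail s) :=
  fun _ _ hab => h (Fin.succ_le_succ_iff.mpr hab)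

theorem headEntry_tail_le {m : ℕ} {s : Fin (m + 1) → ℕ} (h : Antitone s) :
    headEntry (Fin.tail s) ≤ s 0 := by
  cases m with
  | zero => exact Nat.zero_le _
  | succ m => exact h (Fin.zero_le _)

theorem nextEntry_zero {m : ℕ} (s : Fin (m + 1) → ℕ) : nextEntry s 0 = headEntry (Fin.tail s) := by
  simp only [nextEntry, headEntry, Fin.tail]
  by_cases h : 0 < m
  · simp [h]
  · simp [h]

theorem nextEntry_succ {m : ℕ} (s : Fin (m + 1) → ℕ) (j : Fin m) :
    nextEntry s j.succ = nextEntry (Fin.tail s) j := by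
  simp only [nextEntry, Fin.tail]
  by_cases h : (j : ℕ) + 1 < m
  · simp [h]
  · simp [h]

theorem bressoudExponent_zero_succ {m : ℕ} (s : Fin (m + 1) → ℕ) :
    bressoudExponent 0 s = s 0 ^ 2 + bressoudExponent 0 (Fin.tail s) := by
  simp [bressoudExponent, Fin.sum_univ_succ, Fin.tail]

theorem bressoudExponent_succ_succ {m : ℕ} (i : ℕ) (s : Fin (m + 1) → ℕ) :
    bressoudExponent (i + 1) s = s 0 ^ 2 - s 0 + bressoudExponent i (Fin.tail s) := by
  zify [Nat.le_self_pow two_ne_zero (s 0)]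
  rw [bressoudExponent_cast, bressoudExponent_cast, Finset.sum_filter, Finset.sum_filter,
    Fin.sum_univ_succ, Fin.sum_univ_succ]
  simp only [Fin.val_zero, Fin.val_succ, Nat.zero_lt_succ, if_true, Nat.add_lt_add_iff_right,
    Fin.tail]
  ring

theorem bressoudTerm_succ {m : ℕ} {i i' e : ℕ} {s : Fin (m + 1) → ℕ} (hs : Antitone s)
    (he : bressoudExponent i s = e + bressoudExponent i' (Fin.tail s)) :
    bressoudTerm K i s = PowerSeries.X ^ e * (bressoudTerm K i' (Fin.tail s) *
      invFacSeries PowerSeries.X (s 0 - headEntry (Fin.tail s))) := by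
  have h := headEntry_tail_le hs
  have h1 : ((s 0 : ℤ) - headEntry (Fin.tail s)).toNat = s 0 - headEntry (Fin.tail s) := by lia
  rw [bressoudTerm, bressoudTerm, he, Fin.prod_univ_succ, PowerSeries.mul_inv_rev, nextEntry_zero,
    invFacSeries, if_neg (by lia), h1]
  simp only [nextEntry_succ, Fin.tail]
  ring

theorem chainTerm_eq {m i : ℕ} (N : ℕ) {s : Fin m → ℕ} (hs : Antitone s) :
    chainTerm K m i N s = bressoudTerm K i s * invFacSeries PowerSeries.X (N - headEntry s) := by
  induction m generalizing i N with
  | zero => simp [chainTerm, bressoudTerm, bressoudExponent, headEntry]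
  | succ m ih =>
    cases i with
    | zero =>
      rw [chainTerm, ih _ (antitone_tail hs), bressoudTerm_succ hs (bressoudExponent_zero_succ s),
        headEntry_succ]
      ring
    | succ i =>
      rw [chainTerm, ih _ (antitone_tail hs),
        bressoudTerm_succ hs (bressoudExponent_succ_succ i s), headEntry_succ]
      ring

/-- Every entry contributes at least s² - s ≥ 0, and s² - s ≥ s - 1 for the first. This gives
convergence of the sum over tuples. -/
theorem headEntry_le_bressoudExponent {m : ℕ} (i : ℕ) (s : Fin m → ℕ) :
    headEntry s ≤ bressoudExponent i s + 1 := by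
  cases m with
  | zero => exact Nat.zero_le _
  | succ m =>
    have h2 := Nat.le_self_pow two_ne_zero (s 0)
    have h : s 0 ^ 2 - s 0 ≤ bressoudExponent i s := by
      cases i with
      | zero => rw [bressoudExponent_zero_succ]; lia
      | succ i => rw [bressoudExponent_succ_succ]; lia
    rw [headEntry_succ]
    refine le_trans ?_ (Nat.add_le_add_right h 1)
    zify [h2]
    nlinarith [sq_nonneg ((s 0 : ℤ) - 1)]

/-- The sum of the monomials of `q^{j(j-1)/2 + (m+1) j²} (q^{(n-1)j} + ⋯ + q^{-(n-1)j})`. -/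
noncomputable def thetaSum (K : Type*) [Field K] (m n : ℕ) (j : ℤ) : K⟦X⟧ :=
  ∑ k ∈ Finset.range n,
    PowerSeries.X ^ (((2 * m + 3 : ℕ) : ℤ) * tri j + ((m + n - 2 * k : ℕ) : ℤ) * j).toNat

/-- Substituting j² = 2·j(j-1)/2 + j gives the exponents Jacobi form with L = 2m + 3. The condition
n ≤ m + 1 keeps every linear coefficient strictly between 0 and L. -/
theorem algebraMap_thetaSum {m n : ℕ} (hn : n ≤ m + 1) (j : ℤ) :
    ιF (thetaSum K m n j) =
      (ιF PowerSeries.X) ^ (tri j + (m + 1) * j ^ 2) * chebSum (ιF PowerSeries.X) j n := by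
  rw [thetaSum, chebSum, map_sum, Finset.mul_sum]
  refine Finset.sum_congr rfl fun k hk => ?_
  have hk := Finset.mem_range.mp hk
  rw [algebraMap_X_pow_toNat ((abs_nonneg j).trans
    (abs_le_jacobiExponent (by lia) (by lia) j)), ← zpow_add₀ algebraMap_X_ne_zero]
  congr 1
  have h := two_mul_tri j
  have h1 : ((m + n - 2 * k : ℕ) : ℤ) = m + n - 2 * k := by lia
  rw [h1]
  push_cast
  linear_combination (m + 1 : ℤ) * h

theorem sum_chainTerm_eq {m i : ℕ} (him : i ≤ m) (N : ℕ) :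
    ∑ s ∈ Fintype.piFinset fun _ : Fin m => Finset.range (N + 1), chainTerm K m i N s =
      ∑ j ∈ Finset.Icc (-(N : ℤ)) N, (-1) ^ j.natAbs *
        (thetaSum K m (i + 1) j - PowerSeries.X ^ N * thetaSum K m i j) *
        (invFacSeries PowerSeries.X (N - j) * invFacSeries PowerSeries.X (N + j)) := by
  have hX0 : PowerSeries.constantCoeff (PowerSeries.X : K⟦X⟧) = 0 := by simp
  apply IsFractionRing.injective K⟦X⟧ (FractionRing K⟦X⟧)
  rw [algebraMap_sum_chainTerm N m i N le_rfl, nestedSum_eq algebraMap_X_ne_zero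
    algebraMap_X_pow_ne_one N m i N him le_rfl, map_sum]
  refine Finset.sum_congr rfl fun j _ => ?_
  simp only [map_mul, map_sub, map_pow, map_neg, map_one, algebraMap_invFacSeries hX0,
    algebraMap_thetaSum (by lia : i + 1 ≤ m + 1), algebraMap_thetaSum (by lia : i ≤ m + 1),
    neg_one_zpow_eq_pow_natAbs]
  ring

theorem coeff_thetaSum_eq_zero {m n d : ℕ} (hn : n ≤ m + 1) {j : ℤ}
    (hj : j ∉ Finset.Icc (-(d : ℤ)) d) (b c : K⟦X⟧) :
    PowerSeries.coeff d (b * thetaSum K m n j * c) = 0 := by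
  rw [thetaSum, Finset.mul_sum, Finset.sum_mul, map_sum]
  refine Finset.sum_eq_zero fun k hk => ?_
  have hk := Finset.mem_range.mp hk
  exact coeff_mul_X_pow_jacobiExponent_mul (by lia) (by lia) hj b c

end ChainSum

/-! ### Limit and product side -/

/-- The arguments on the left are i, i - 2, …, -i. Reflecting the positive ones by b ↦ 1 - b fills
the gaps, giving -i, …, 0. -/
theorem sum_reflect_step_two {A : Type*} [AddCommMonoid A] (f : ℤ → A) (hf : ∀ b, f (1 - b) = f b)
    (i : ℕ) :
    ∑ k ∈ Finset.range (i + 1), f (i - 2 * k) = ∑ k ∈ Finset.range (i + 1), f (k - i) := by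
  induction i using Nat.twoStepInduction with
  | zero => simp
  | one =>
    have := hf 0
    simp only [sub_zero] at this
    simp [Finset.sum_range_succ, this, add_comm]
  | more i ih _ =>
    rw [Finset.sum_range_succ', Finset.sum_range_succ, Finset.sum_range_succ' _ (i + 2),
      Finset.sum_range_succ' _ (i + 1)]
    have e1 : ∀ k : ℕ, ((i + 2 : ℕ) : ℤ) - 2 * (k + 1 : ℕ) = i - 2 * k := fun k => by
      push_cast; ring
    have e2 : ∀ k : ℕ, ((k + 1 + 1 : ℕ) : ℤ) - (i + 2 : ℕ) = k - i := fun k => by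
      push_cast; ring
    have e3 : ((i + 2 : ℕ) : ℤ) - 2 * (0 : ℕ) = 1 - ((0 + 1 : ℕ) - (i + 2 : ℕ)) := by
      push_cast; ring
    have e4 : (i : ℤ) - 2 * (i + 1 : ℕ) = (0 : ℕ) - (i + 2 : ℕ) := by
      push_cast; ring
    simp only [e1, e2]
    rw [e3, e4, hf, ih, add_right_comm]

section Main

open Filter Topology

variable {K : Type*} [Field K] [TopologicalSpace K] [DiscreteTopology K]

theorem hasSum_thetaSum {m i : ℕ} (him : i ≤ m) :
    HasSum (fun j : ℤ => (-1) ^ j.natAbs * thetaSum K m (i + 1) j)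
      (∑ k ∈ Finset.range (i + 1),
        qFactorialInf₃ (PowerSeries.X ^ (2 * m + 3)) (PowerSeries.X ^ (m + 1 - i + k))
          (PowerSeries.X ^ (m + 1 + i - k + 1)) (PowerSeries.X ^ (2 * m + 3))) := by
  have h : HasSum (fun j : ℤ => ∑ k ∈ Finset.range (i + 1), (-1) ^ j.natAbs *
      (PowerSeries.X : K⟦X⟧) ^
        (((2 * m + 3 : ℕ) : ℤ) * tri j + ((m + (i + 1) - 2 * k : ℕ) : ℤ) * j).toNat) _ :=
    hasSum_sum fun k hk => by
      have hk := Finset.mem_range.mp hk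
      exact hasSum_jacobi (by lia) (by lia)
  refine h.of_eq_of_eq (fun j => by rw [thetaSum, Finset.mul_sum]) ?_
  -- The exponents of the two factors are m + 1 + b and m + 2 - b; b ↦ 1 - b swaps them.
  have h2 := sum_reflect_step_two (fun b : ℤ => qFactorialInf₃ ((PowerSeries.X : K⟦X⟧) ^ (2 * m + 3))
    (PowerSeries.X ^ ((m : ℤ) + 1 + b).toNat) (PowerSeries.X ^ ((m : ℤ) + 2 - b).toNat)
    (PowerSeries.X ^ (2 * m + 3))) (fun b => by
      rw [qFactorialInf₃, qFactorialInf₃, mul_right_comm]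
      congr 4 <;> lia) i
  convert h2 using 1
  · refine Finset.sum_congr rfl fun k hk => ?_
    have hk := Finset.mem_range.mp hk
    congr 2 <;> lia
  · refine Finset.sum_congr rfl fun k hk => ?_
    have hk := Finset.mem_range.mp hk
    congr 2 <;> lia

/-- The part of the coefficient multiplied by X^N tends to 0, and each kernel tends to (X;X)_∞⁻². -/
theorem tendsto_sum_chainTerm {m i : ℕ} (him : i ≤ m) :
    Tendsto (fun N => ∑ s ∈ Fintype.piFinset fun _ : Fin m => Finset.range (N + 1),
      chainTerm K m i N s) atTop
      (𝓝 ((∑ k ∈ Finset.range (i + 1),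
        qFactorialInf₃ (PowerSeries.X ^ (2 * m + 3)) (PowerSeries.X ^ (m + 1 - i + k))
          (PowerSeries.X ^ (m + 1 + i - k + 1)) (PowerSeries.X ^ (2 * m + 3))) *
        ((qFactorialInf PowerSeries.X PowerSeries.X)⁻¹ *
          (qFactorialInf PowerSeries.X PowerSeries.X)⁻¹))) := by
  have hX0 : PowerSeries.constantCoeff (PowerSeries.X : K⟦X⟧) = 0 := by simp
  have hg := (hasSum_thetaSum (K := K) him).mul_right
    ((qFactorialInf PowerSeries.X PowerSeries.X)⁻¹ *
      (qFactorialInf PowerSeries.X PowerSeries.X)⁻¹)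
  refine (hasSum_iff_tendsto_of_eventually_coeff_eq_zero
    (f := fun (N : ℕ) (j : ℤ) => (-1) ^ j.natAbs *
        (thetaSum K m (i + 1) j - PowerSeries.X ^ N * thetaSum K m i j) *
        (invFacSeries PowerSeries.X (N - j) * invFacSeries PowerSeries.X (N + j)))
    (g := fun j : ℤ => (-1) ^ j.natAbs * thetaSum K m (i + 1) j *
      ((qFactorialInf PowerSeries.X PowerSeries.X)⁻¹ *
          (qFactorialInf PowerSeries.X PowerSeries.X)⁻¹))
    (fun N => ?_) (fun j => ?_) (fun d => ⟨Finset.Icc (-(d : ℤ)) d, fun j hj N => ?_⟩)).mp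
    hg
  · rw [sum_chainTerm_eq him]
    refine hasSum_sum_of_ne_finset_zero fun j hj => ?_
    rw [Finset.mem_Icc, not_and_or, not_le, not_le] at hj
    rcases hj with h | h
    · rw [invFacSeries_of_neg _ (n := N + j) (by lia)]; ring
    · rw [invFacSeries_of_neg _ (n := N - j) (by lia)]; ring
  · refine Tendsto.mul (tendsto_const_nhds.mul ?_)
      (Tendsto.mul ?_ (tendsto_invFacSeries_add hX0 j))
    · have hXN : Tendsto (fun N : ℕ => (PowerSeries.X : K⟦X⟧) ^ N) atTop (𝓝 0) :=
        PowerSeries.WithPiTopology.isTopologicallyNilpotent_of_constantCoeff_zero hX0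
      simpa using (tendsto_const_nhds (x := thetaSum K m (i + 1) j)).sub
        (hXN.mul (tendsto_const_nhds (x := thetaSum K m i j)))
    · simpa only [sub_eq_add_neg] using tendsto_invFacSeries_add hX0 (-j)
  · have e : ∀ a b x y c : K⟦X⟧, a * (x - b * y) * c = a * x * c - a * b * y * c := by
      intros; ring
    rw [e, map_sub, coeff_thetaSum_eq_zero (by lia) hj, coeff_thetaSum_eq_zero (by lia) hj,
      sub_zero]

theorem hasSum_bressoudTerm {m i : ℕ} (him : i ≤ m) :
    HasSum (fun s : {s : Fin m → ℕ // Antitone s} => bressoudTerm K i s.1)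
      (∑ k ∈ Finset.range (i + 1),
        qFactorialInf₃ (PowerSeries.X ^ (2 * m + 3)) (PowerSeries.X ^ (m + 1 - i + k))
            (PowerSeries.X ^ (m + 1 + i - k + 1)) (PowerSeries.X ^ (2 * m + 3)) *
          (qFactorialInf (PowerSeries.X : K⟦X⟧) PowerSeries.X)⁻¹) := by
  classical
  have hX0 : PowerSeries.constantCoeff (PowerSeries.X : K⟦X⟧) = 0 := by simp
  have key := (hasSum_iff_tendsto_of_eventually_coeff_eq_zero
    (f := fun (N : ℕ) (s : {s : Fin m → ℕ // Antitone s}) => chainTerm K m i N s.1)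
    (g := fun s => bressoudTerm K i s.1 * (qFactorialInf PowerSeries.X PowerSeries.X)⁻¹)
    (fun N => ?_) (fun s => ?_) (fun d => ⟨(Fintype.piFinset fun _ : Fin m =>
      Finset.range (d + 2)).subtype Antitone, fun s hs N => ?_⟩)).mpr (tendsto_sum_chainTerm him)
  · have h1 := qFactorialInf_mul_inv hX0
    refine (key.mul_right (qFactorialInf PowerSeries.X PowerSeries.X)).of_eq_of_eq
      (fun s => ?_) ?_
    · linear_combination bressoudTerm K i s.1 * h1
    · rw [← Finset.sum_mul]
      generalize (∑ k ∈ Finset.range (i + 1), _ : K⟦X⟧) = A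
      linear_combination A * (qFactorialInf (PowerSeries.X : K⟦X⟧) PowerSeries.X)⁻¹ * h1
  · refine (hasSum_subtype_iff_of_support_subset (s := {s | Antitone s})
      (f := chainTerm K m i N) fun s hs => (antitone_of_chainTerm_ne_zero hs).1).mpr ?_
    refine hasSum_sum_of_ne_finset_zero fun s hs => ?_
    by_contra h
    obtain ⟨h1, h2⟩ := antitone_of_chainTerm_ne_zero h
    refine hs (Fintype.mem_piFinset.mpr fun j => Finset.mem_range.mpr ?_)
    have := le_headEntry h1 j
    lia
  · simp only [chainTerm_eq _ s.2]
    refine tendsto_const_nhds.mul ?_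
    simpa only [sub_eq_add_neg] using tendsto_invFacSeries_add hX0 (-(headEntry s.1 : ℤ))
  -- An exponent at most d forces all entries to be at most d + 1, hence the box `Finset.range (d +
  -- 2)`.
  · have hd : d < bressoudExponent i s.1 := by
      by_contra hcon
      refine hs (Finset.mem_subtype.mpr (Fintype.mem_piFinset.mpr fun j =>
        Finset.mem_range.mpr ?_))
      have h1 := le_headEntry s.2 j
      have h2 := headEntry_le_bressoudExponent i s.1
      lia
    rw [chainTerm_eq _ s.2, bressoudTerm, mul_assoc]
    exact PowerSeries.X_pow_dvd_iff.mp (dvd_mul_right _ _) d hd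

end Main

theorem mainTheorem4 (K : Type*) [Field K] [TopologicalSpace K] [DiscreteTopology K]
    (r i : ℕ) (hr : 0 < r) (hi : i ≤ r - 1) :
    HasSum
      (fun s : {s : Fin (r - 1) → ℕ // Antitone s} => bressoudTerm K i s.1)
      (∑ k ∈ Finset.range (i + 1),
        qFactorialInf₃ (PowerSeries.X ^ (2 * r + 1)) (PowerSeries.X ^ (r - i + k))
            (PowerSeries.X ^ (r + i - k + 1)) (PowerSeries.X ^ (2 * r + 1)) *
          (qFactorialInf (PowerSeries.X : K⟦X⟧) PowerSeries.X)⁻¹) := by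
  obtain ⟨m, rfl⟩ : ∃ m, r = m + 1 := ⟨r - 1, by lia⟩
  exact hasSum_bressoudTerm hi
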